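/- **Corollary (Expression for the average gate fidelity).** Let $d\ge 2$ and let $T=\operatorname{diag}(t_0,\dots,t_{d-1})$ be a diagonal unitary gate of finite order (the $t_i$ are $N$-th roots of unity for some $N\ge 1$) that is not a scalar multiple of the identity. For $\sigma\in S_d$ let $P_\sigma$ be the permutation matrix $P_\sigma|i\rangle=|\sigma(i)\rangle$, and let $\mathbf T'$ be the finite abelian group (a product of cyclic groups) generated by the diagonal matrices $P_\sigma T P_\sigma^\dagger$, $\sigma\in S_d$. The real hyperdihedral group is the semidirect product $\mathbb G = S_d\ltimes \mathbf T'$, where $S_d$ acts by conjugation with the $P_\sigma$; let $\gamma$ be its $d$-dimensional representation $(\sigma,D)\mapsto P_\sigma D$. The ideal gates are $\mathcal E_g=\gamma(g)\otimes\overline{\gamma(g)}$, acting on $\mathbb C^{d^2}$, the space of vectorised $d\times d$ matrices. Let $$\Sigma_{\mathbb I},\quad \Sigma_0,\quad \Sigma_+$$ be, respectively, the component of the trivial representation in $g\mapsto\mathcal E_g$ (the fixed vectors), the component of the standard $(d-1)$-dimensional irreducible representation of $S_d$ (the sum of the images of all intertwining maps from it, viewed as a representation of $\mathbb G$), and the orthogonal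 complement of $\Sigma_{\mathbb I}+\Sigma_0$; let $\Pi_\varpi$ be the orthogonal projector onto $\Sigma_\varpi$. Let $\mathcal E=\sum_{A\in\mathbf A}A\otimes\bar A$, with $\mathbf A$ a finite set of $d\times d$ complex matrices and $\sum_{A\in\mathbf A} A^\dagger A=\mathbb I_d$, be a quantum channel, and suppose that the gate set has the gate-independent noise $\mathcal E$, i.e. the noisy gates are $\tilde{\mathcal E}_g=\mathcal E\,\mathcal E_g$ for all $g\in\mathbb G$. Put $$\eta_\varpi=\frac{\operatorname{tr}(\mathcal E\,\Pi_\varpi)}{\dim \Sigma_\varpi},\qquad \varpi\in\{\mathbb I,0,+\}.$$ For each $g$ let $F(\mathcal E_g,\tilde{\mathcal E}_g)$ be the average gate fidelity, that is the average of $\operatorname{tr}\big(\mathcal E_g(|\psi\rangle\langle\psi|)^\dagger\,\tilde{\mathcal E}_g(|\psi\rangle\langle\psi|)\big)$ over all unit vectors $\psi\in\mathbb C^d$ with respect to the unitarily invariant probability measure. Then the average gate fidelity over the group, $F(\mathbb G)=|\mathbb G|^{-1}\sum_{g\in\mathbb G}F(\mathcal E_g,\tilde{\mathcal E}_g)$,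 is $$F(\mathbb G)=\frac{d\big(\eta_{\mathbb I}+(d-1)\,\eta_0+(d^2-d)\,\eta_+\big)+d^2}{d^2(d+1)} .$$ The same value is obtained if $F(\mathcal E_g,\tilde{\mathcal E}_g)$ is replaced by the expression $\frac{1}{d(d+1)}\operatorname{tr}(\tilde{\mathcal E}_g^\dagger\mathcal E_g)+\frac1{d+1}$. -/

import Mathlib

open scoped Matrix Kronecker ComplexConjugate

namespace RHDG

/-! ### Channels in the Kraus (Liouville) representation -/

section Channels

/-- The `d² × d²` matrices acting on vectorised `d × d` matrices. -/
abbrev SuperOp (d : ℕ) : Type := Matrix (Fin d × Fin d) (Fin d × Fin d) ℂ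

/-- The Hilbert space of vectorised `d × d` matrices; the coordinate at `(i, j)` is the
`(i, j)` entry of the matrix. -/
abbrev LSpace (d : ℕ) : Type := EuclideanSpace ℂ (Fin d × Fin d)

/-- `A ⊗ Ā`, which acts on vectorised matrices as `ρ ↦ A ρ A†`. -/
def conjKron {d : ℕ} (A : Matrix (Fin d) (Fin d) ℂ) : SuperOp d :=
  A ⊗ₖ A.map (fun z => conj z)

/-- The set of channels (completely positive trace preserving maps): the matrices
`∑ A ⊗ Ā` over finite sets of Kraus operators with `∑ A† A = 1`. -/
def channels (d : ℕ) : Set (SuperOp d) :=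
  {E | ∃ S : Finset (Matrix (Fin d) (Fin d) ℂ),
    ∑ A ∈ S, Aᴴ * A = 1 ∧ E = ∑ A ∈ S, conjKron A}

theorem conjKron_one {d : ℕ} : conjKron (1 : Matrix (Fin d) (Fin d) ℂ) = 1 := by
  unfold conjKron
  rw [Matrix.map_one _ (map_zero _) (map_one _), Matrix.one_kronecker_one]

theorem conjKron_mul {d : ℕ} (A B : Matrix (Fin d) (Fin d) ℂ) :
    conjKron (A * B) = conjKron A * conjKron B := by
  unfold conjKron
  rw [← Matrix.mul_kronecker_mul]
  congr 1
  exact Matrix.map_mul (f := starRingEnd ℂ)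

end Channels

/-! ### The real hyperdihedral group of a diagonal gate

The diagonal gate `T = diag(t 0, …, t (d-1))` has finite order, its entries being `N`-th roots
of unity for some `N ≥ 1`. -/

section Group

variable {d N : ℕ}

/-- Permutation of the diagonal entries: `diag (permPhase σ a) = P_σ diag(a) P_σ†`, where
`P_σ |i⟩ = |σ i⟩`. -/
def permPhase (d N : ℕ) : Equiv.Perm (Fin d) →* MulAut (Fin d → rootsOfUnity N ℂ) where
  toFun σ :=
    { toFun := fun a i => a (σ⁻¹ i)
      invFun := fun a i => a (σ i)
      left_inv := fun a => by funext i; simp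
      right_inv := fun a => by funext i; simp
      map_mul' := fun _ _ => rfl }
  map_one' := rfl
  map_mul' σ τ := by ext a i; simp [mul_inv_rev]

theorem permPhase_apply (σ : Equiv.Perm (Fin d)) (a : Fin d → rootsOfUnity N ℂ) (i : Fin d) :
    permPhase d N σ a i = a (σ⁻¹ i) := rfl

/-- The finite abelian group generated by all the diagonal matrices `P_σ T P_σ†`
(each diagonal matrix is recorded by its diagonal). -/
def phaseGroup (t : Fin d → rootsOfUnity N ℂ) : Subgroup (Fin d → rootsOfUnity N ℂ) :=
  Subgroup.closure (Set.range fun σ => permPhase d N σ t)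

theorem permPhase_mem {t a : Fin d → rootsOfUnity N ℂ} (σ : Equiv.Perm (Fin d))
    (ha : a ∈ phaseGroup t) : permPhase d N σ a ∈ phaseGroup t := by
  have h : phaseGroup t ≤ (phaseGroup t).comap (permPhase d N σ).toMonoidHom := by
    refine (Subgroup.closure_le _).2 ?_
    rintro _ ⟨τ, rfl⟩
    refine Subgroup.subset_closure ⟨σ * τ, ?_⟩
    simp [map_mul]
  exact h ha

/-- The action of the symmetric group on `phaseGroup t` by permutation of the diagonal. -/
def phaseAction (t : Fin d → rootsOfUnity N ℂ) :
    Equiv.Perm (Fin d) →* MulAut (phaseGroup t) where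
  toFun σ :=
    { toFun := fun a => ⟨permPhase d N σ a, permPhase_mem σ a.2⟩
      invFun := fun a => ⟨permPhase d N σ⁻¹ a, permPhase_mem σ⁻¹ a.2⟩
      left_inv := fun a => Subtype.ext (funext fun i => by
        change (a : Fin d → rootsOfUnity N ℂ) (σ⁻¹ (σ⁻¹⁻¹ i)) = _
        simp)
      right_inv := fun a => Subtype.ext (funext fun i => by
        change (a : Fin d → rootsOfUnity N ℂ) (σ⁻¹⁻¹ (σ⁻¹ i)) = _
        simp)
      map_mul' := fun a b => Subtype.ext (map_mul (permPhase d N σ) _ _) }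
  map_one' := by ext a i; simp
  map_mul' σ τ := by ext a i; simp [permPhase_apply, mul_inv_rev]

/-- The real hyperdihedral group: the semidirect product of the symmetric group with the finite
abelian group (a product of cyclic groups) generated by the permuted copies of the gate. -/
abbrev HyperdihedralGroup (t : Fin d → rootsOfUnity N ℂ) : Type :=
  phaseGroup t ⋊[phaseAction t] Equiv.Perm (Fin d)

noncomputable instance instFintypeGroup [NeZero N] (t : Fin d → rootsOfUnity N ℂ) :
    Fintype (HyperdihedralGroup t) :=
  haveI : Finite (phaseGroup t × Equiv.Perm (Fin d)) := inferInstance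
  haveI : Finite (HyperdihedralGroup t) := Finite.of_equiv _ SemidirectProduct.equivProd.symm
  Fintype.ofFinite _

/-- The permutation matrix `P_σ`, with `P_σ |j⟩ = |σ j⟩`. -/
def permMat (σ : Equiv.Perm (Fin d)) : Matrix (Fin d) (Fin d) ℂ :=
  Matrix.of fun i j => if i = σ j then 1 else 0

/-- The diagonal unitary matrix with diagonal `a`. -/
def phaseMat (a : Fin d → rootsOfUnity N ℂ) : Matrix (Fin d) (Fin d) ℂ :=
  Matrix.diagonal fun i => ((a i : ℂˣ) : ℂ)

theorem permMat_one : permMat (1 : Equiv.Perm (Fin d)) = 1 := by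
  ext i j
  simp [permMat, Matrix.one_apply]
  rfl

theorem permMat_mul (σ τ : Equiv.Perm (Fin d)) : permMat (σ * τ) = permMat σ * permMat τ := by
  ext i j
  simp [permMat, Matrix.mul_apply]
  rfl

theorem phaseMat_one : phaseMat (1 : Fin d → rootsOfUnity N ℂ) = 1 := by
  simp [phaseMat]

theorem phaseMat_mul (a b : Fin d → rootsOfUnity N ℂ) :
    phaseMat (a * b) = phaseMat a * phaseMat b := by
  simp [phaseMat, Matrix.diagonal_mul_diagonal]

theorem permMat_mul_phaseMat (σ : Equiv.Perm (Fin d)) (a : Fin d → rootsOfUnity N ℂ) :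
    permMat σ * phaseMat a = phaseMat (permPhase d N σ a) * permMat σ := by
  ext i j
  rw [phaseMat, phaseMat, Matrix.mul_diagonal, Matrix.diagonal_mul]
  by_cases h : i = σ j
  · subst h
    simp [permMat, permPhase_apply]
  · simp [permMat, h]

/-- The defining `d`-dimensional representation `γ` of the group:
`(a, σ) ↦ diag(a) P_σ = P_σ diag(σ⁻¹ · a)`. -/
def gamma (t : Fin d → rootsOfUnity N ℂ) :
    HyperdihedralGroup t →* Matrix (Fin d) (Fin d) ℂ where
  toFun g := phaseMat (g.left : Fin d → rootsOfUnity N ℂ) * permMat g.right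
  map_one' := by
    rw [SemidirectProduct.one_left, SemidirectProduct.one_right, permMat_one, mul_one]
    exact phaseMat_one
  map_mul' g h := by
    have e : (((g * h).left : phaseGroup t) : Fin d → rootsOfUnity N ℂ)
        = g.left * permPhase d N g.right h.left := rfl
    rw [e, SemidirectProduct.mul_right, phaseMat_mul, permMat_mul, mul_assoc, mul_assoc,
      ← mul_assoc (permMat g.right), permMat_mul_phaseMat, mul_assoc]

/-- The ideal gates: the representation `g ↦ γ(g) ⊗ conj γ(g)`. -/
def idealGate (t : Fin d → rootsOfUnity N ℂ) : HyperdihedralGroup t →* SuperOp d where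
  toFun g := conjKron (gamma t g)
  map_one' := by rw [map_one, conjKron_one]
  map_mul' g h := by rw [map_mul, conjKron_mul]

/-- The noisy gates with gate-independent noise `E`: first the ideal gate, then `E`. -/
def noisyGate (t : Fin d → rootsOfUnity N ℂ) (E : SuperOp d) (g : HyperdihedralGroup t) :
    SuperOp d :=
  E * idealGate t g

end Group

/-! ### The three subspaces of the space of vectorised matrices -/

section Decomposition

variable {d N : ℕ}

/-- The ideal gates as a complex representation on the Hilbert space of vectorised matrices. -/
noncomputable def channelRep (t : Fin d → rootsOfUnity N ℂ) :
    Representation ℂ (HyperdihedralGroup t) (LSpace d) :=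
  (Matrix.toLpLinAlgEquiv (R := ℂ) 2 : SuperOp d ≃ₐ[ℂ] Module.End ℂ (LSpace d)).toMonoidHom.comp
    (idealGate t)

/-- The space of vectors in `ℂᵈ` with coordinate sum zero. -/
def stdSpace (d : ℕ) : Submodule ℂ (Fin d → ℂ) :=
  LinearMap.ker (∑ i, LinearMap.proj i : (Fin d → ℂ) →ₗ[ℂ] ℂ)

theorem mem_stdSpace {v : Fin d → ℂ} : v ∈ stdSpace d ↔ ∑ i, v i = 0 := by
  simp [stdSpace, LinearMap.mem_ker]

/-- The standard irreducible representation of the symmetric group (of dimension `d - 1`), on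
the vectors with coordinate sum zero, by permutation of the coordinates. -/
def stdRep (d : ℕ) : Representation ℂ (Equiv.Perm (Fin d)) (stdSpace d) where
  toFun σ := (LinearMap.funLeft ℂ ℂ (σ⁻¹ : Equiv.Perm (Fin d))).restrict fun v hv => by
    rw [mem_stdSpace] at hv ⊢
    rw [← hv]
    exact Equiv.sum_comp (σ⁻¹ : Equiv.Perm (Fin d)) v
  map_one' := by ext v i; simp [LinearMap.funLeft_apply]
  map_mul' σ τ := by ext v i; simp [LinearMap.funLeft_apply, mul_inv_rev]

/-- The standard irreducible representation, as a representation of the hyperdihedral group. -/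
def stdRepGroup (t : Fin d → rootsOfUnity N ℂ) :
    Representation ℂ (HyperdihedralGroup t) (stdSpace d) :=
  (stdRep d).comp SemidirectProduct.rightHom

/-- `Σ_𝕀`: the component of the trivial representation. -/
noncomputable def sigmaTriv (t : Fin d → rootsOfUnity N ℂ) : Submodule ℂ (LSpace d) :=
  (channelRep t).invariants

/-- `Σ_0`: the component of the standard representation, that is the sum of the images of all
the intertwining maps from the standard representation. -/
noncomputable def sigmaStd (t : Fin d → rootsOfUnity N ℂ) : Submodule ℂ (LSpace d) :=
  ⨆ f : (stdRepGroup t).IntertwiningMap (channelRep t), LinearMap.range f.toLinearMap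

/-- `Σ_+`: the complement of the two other components. -/
noncomputable def sigmaPlus (t : Fin d → rootsOfUnity N ℂ) : Submodule ℂ (LSpace d) :=
  (sigmaTriv t ⊔ sigmaStd t)ᗮ

/-- `tr(E Π) / dim V`, where `Π` is the orthogonal projector onto the subspace `V`. -/
noncomputable def eta (E : SuperOp d) (V : Submodule ℂ (LSpace d)) : ℂ :=
  LinearMap.trace ℂ (LSpace d)
    ((Matrix.toLpLinAlgEquiv 2 E : Module.End ℂ (LSpace d)) ∘ₗ
      (V.starProjection : LSpace d →ₗ[ℂ] LSpace d)) / (Module.finrank ℂ V : ℂ)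

end Decomposition

/-! ### Average gate fidelity -/

section Fidelity

open MeasureTheory

variable {d N : ℕ}

/-- The (unnormalised) unitarily invariant surface measure on the unit vectors of `ℂᵈ`. -/
noncomputable def stateMeasure (d : ℕ) :
    Measure (Metric.sphere (0 : EuclideanSpace ℂ (Fin d)) 1) :=
  (Measure.addHaar : Measure (EuclideanSpace ℂ (Fin d))).toSphere

/-- The vectorisation of `|ψ⟩⟨ψ|`. -/
def pureState (ψ : EuclideanSpace ℂ (Fin d)) : Fin d × Fin d → ℂ :=
  fun p => ψ p.1 * conj (ψ p.2)

/-- The average gate fidelity of the implementation `F` of the ideal gate `E`: the average over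
all pure states `ψ`, with respect to the unitarily invariant probability measure, of the
Hilbert-Schmidt overlap `⟪E(|ψ⟩⟨ψ|), F(|ψ⟩⟨ψ|)⟫`. -/
noncomputable def gateFidelity (E F : SuperOp d) : ℂ :=
  ⨍ ψ, star (E *ᵥ pureState (ψ : EuclideanSpace ℂ (Fin d))) ⬝ᵥ
    (F *ᵥ pureState (ψ : EuclideanSpace ℂ (Fin d))) ∂(stateMeasure d)

/-- The trace expression `tr(F† E) / (d (d + 1)) + 1 / (d + 1)` for the gate fidelity. -/
noncomputable def traceFidelity (E F : SuperOp d) : ℂ :=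
  1 / ((d : ℂ) * ((d : ℂ) + 1)) * (Fᴴ * E).trace + 1 / ((d : ℂ) + 1)

/-- The average over the hyperdihedral group of a fidelity between the ideal gates and the noisy
gates with gate-independent noise `E`. -/
noncomputable def groupFidelity [NeZero N] (fid : SuperOp d → SuperOp d → ℂ)
    (t : Fin d → rootsOfUnity N ℂ) (E : SuperOp d) : ℂ :=
  (Fintype.card (HyperdihedralGroup t) : ℂ)⁻¹ *
    ∑ g : HyperdihedralGroup t, fid (idealGate t g) (noisyGate t E g)

end Fidelity

end RHDG

/-!
Both sides equal `tr E / (d (d + 1)) + 1 / (d + 1)`.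

*The right-hand side.* An entry `(i, j)` of a matrix, `i ≠ j`, is multiplied by a nontrivial phase by
some element of the phase group, because a permuted copy of the non-scalar gate takes different
values at `i` and `j`. So whatever the phases fix is a diagonal matrix (`eq_diagEmb_of_phase_fixed`),
and on diagonal matrices the group acts as the permutation representation of the symmetric group.
Hence the trivial component consists of the scalar matrices (`sigmaTriv_eq`) and the standard
component of the diagonal matrices of trace zero (`sigmaStd_eq`). These are orthogonal, of dimensions
`1` and `d - 1`, and the three orthogonal projectors add up to the identity, so that
`tr E = η_𝕀 + (d - 1) η_0 + (d² - d) η_+` (`trace_eq_sum_eta`).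

*The trace expression.* The ideal gates are unitary and cancel in `tr(F† E_g)`, leaving the
conjugate of `tr E = ∑ |tr A|²`, which is real.

*The average over pure states.* The surface measure of the unit sphere is invariant under unitaries.
The substitution `ψ ↦ γ(g) ψ` therefore removes the gate (`gateFidelity_conjKron`), and it remains to
average `⟪|ψ⟩⟨ψ|, E(|ψ⟩⟨ψ|)⟫`, a combination of fourth moments `𝔼 ψᵢ ψ̄ⱼ ψₖ ψ̄ₗ`. These are
determined by invariance and normalisation (`fourthMoment_eq`): diagonal unitaries kill all moments
but the two pairings, a reflection in a coordinate plane gives `𝔼 |ψᵢ|⁴ = 2 𝔼 |ψᵢ|²|ψⱼ|²`, and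
`‖ψ‖ = 1` fixes the scale. The average is `(∑ᵢₖ E_{ii,kk} + tr E) / (d (d + 1))`, where the double
sum is `d` because `E` preserves the trace.
-/

namespace RHDG

/-! ### The ideal gates are unitary -/

section Unitary

variable {d N : ℕ}

theorem phase_mul_conj (z : rootsOfUnity N ℂ) [NeZero N] :
    ((z : ℂˣ) : ℂ) * conj ((z : ℂˣ) : ℂ) = 1 := by
  rw [Complex.mul_conj, Complex.normSq_eq_norm_sq,
    Complex.norm_eq_one_of_mem_rootsOfUnity z.2]
  simp

theorem phaseMat_mem_unitaryGroup [NeZero N] (a : Fin d → rootsOfUnity N ℂ) :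
    phaseMat a ∈ Matrix.unitaryGroup (Fin d) ℂ := by
  rw [Matrix.mem_unitaryGroup_iff, phaseMat, Matrix.star_eq_conjTranspose,
    Matrix.diagonal_conjTranspose, Matrix.diagonal_mul_diagonal, ← Matrix.diagonal_one]
  congr 1
  funext i
  exact phase_mul_conj (a i)

theorem permMat_conjTranspose (σ : Equiv.Perm (Fin d)) : (permMat σ)ᴴ = permMat σ⁻¹ := by
  ext i j
  have h : j = σ i ↔ i = σ⁻¹ j := by rw [Equiv.Perm.eq_inv_iff_eq, eq_comm]
  rw [Matrix.conjTranspose_apply, permMat, permMat, Matrix.of_apply, Matrix.of_apply,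
    if_congr h rfl rfl]
  split_ifs <;> simp

theorem permMat_mem_unitaryGroup (σ : Equiv.Perm (Fin d)) :
    permMat σ ∈ Matrix.unitaryGroup (Fin d) ℂ := by
  rw [Matrix.mem_unitaryGroup_iff, Matrix.star_eq_conjTranspose, permMat_conjTranspose,
    ← permMat_mul, mul_inv_cancel, permMat_one]

theorem gamma_mem_unitaryGroup [NeZero N] (t : Fin d → rootsOfUnity N ℂ)
    (g : HyperdihedralGroup t) : gamma t g ∈ Matrix.unitaryGroup (Fin d) ℂ :=
  mul_mem (phaseMat_mem_unitaryGroup _) (permMat_mem_unitaryGroup _)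

theorem conjKron_conjTranspose (A : Matrix (Fin d) (Fin d) ℂ) :
    (conjKron A)ᴴ = conjKron Aᴴ := by
  ext p q
  simp [conjKron, Matrix.conjTranspose_apply]

theorem idealGate_mul_conjTranspose [NeZero N] (t : Fin d → rootsOfUnity N ℂ)
    (g : HyperdihedralGroup t) : idealGate t g * (idealGate t g)ᴴ = 1 := by
  change conjKron (gamma t g) * (conjKron (gamma t g))ᴴ = 1
  rw [conjKron_conjTranspose, ← conjKron_mul, ← Matrix.star_eq_conjTranspose,
    Matrix.mem_unitaryGroup_iff.1 (gamma_mem_unitaryGroup t g), conjKron_one]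

theorem conjKron_trace (A : Matrix (Fin d) (Fin d) ℂ) :
    (conjKron A).trace = A.trace * conj A.trace := by
  rw [conjKron, Matrix.trace_kronecker]
  simp [Matrix.trace]

/-- The trace of a channel is `∑ |tr A|²` over its Kraus operators, hence real. -/
theorem conj_trace_of_mem_channels {E : SuperOp d} (hE : E ∈ channels d) :
    conj E.trace = E.trace := by
  obtain ⟨S, -, rfl⟩ := hE
  simp [Matrix.trace_sum, conjKron_trace, mul_comm]

/-- Trace preservation, read off from the matrix entries of a channel: `tr E(|k⟩⟨k|) = 1`. -/
theorem sum_diag_of_mem_channels {E : SuperOp d} (hE : E ∈ channels d) (k : Fin d) :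
    ∑ i, E (i, i) (k, k) = 1 := by
  obtain ⟨S, hS, rfl⟩ := hE
  have h := congrFun (congrFun hS k) k
  rw [Matrix.sum_apply, Matrix.one_apply_eq] at h
  rw [← h]
  simp only [Matrix.sum_apply]
  rw [Finset.sum_comm]
  simp [conjKron, Matrix.mul_apply, mul_comm]

theorem traceFidelity_noisyGate [NeZero N] (t : Fin d → rootsOfUnity N ℂ) {E : SuperOp d}
    (hE : E ∈ channels d) (g : HyperdihedralGroup t) :
    traceFidelity (idealGate t g) (noisyGate t E g)
      = 1 / ((d : ℂ) * ((d : ℂ) + 1)) * E.trace + 1 / ((d : ℂ) + 1) := by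
  have h : ((noisyGate t E g)ᴴ * idealGate t g).trace = E.trace := by
    rw [noisyGate, Matrix.conjTranspose_mul, mul_assoc, Matrix.trace_mul_comm, mul_assoc,
      idealGate_mul_conjTranspose, mul_one, Matrix.trace_conjTranspose]
    exact conj_trace_of_mem_channels hE
  rw [traceFidelity, h]

end Unitary

/-! ### Orthogonal projectors -/

section Ortho

variable {V : Type*} [NormedAddCommGroup V] [InnerProductSpace ℂ V] [FiniteDimensional ℂ V]

theorem starProjection_sup_of_isOrtho {U W : Submodule ℂ V} (h : U ⟂ W) :
    (U ⊔ W).starProjection = U.starProjection + W.starProjection := by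
  ext x
  refine (Submodule.eq_starProjection_of_mem_orthogonal
    (add_mem (Submodule.mem_sup_left (U.starProjection_apply_mem x))
      (Submodule.mem_sup_right (W.starProjection_apply_mem x))) ?_)
  rw [← Submodule.inf_orthogonal]
  constructor
  · rw [add_apply, ← sub_sub]
    exact sub_mem (U.sub_starProjection_mem_orthogonal x) (h.ge (W.starProjection_apply_mem x))
  · rw [add_apply, add_comm, ← sub_sub]
    exact sub_mem (W.sub_starProjection_mem_orthogonal x) (h.le (U.starProjection_apply_mem x))

end Ortho

/-! ### The decomposition of the space of vectorised matrices -/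

section Components

variable {d N : ℕ}

theorem channelRep_apply (t : Fin d → rootsOfUnity N ℂ) (g : HyperdihedralGroup t)
    (x : LSpace d) (i j : Fin d) :
    channelRep t g x (i, j) =
      ((((g.left : Fin d → rootsOfUnity N ℂ) i : ℂˣ) : ℂ)
        * conj (((g.left : Fin d → rootsOfUnity N ℂ) j : ℂˣ) : ℂ))
        * x (g.right⁻¹ i, g.right⁻¹ j) := by
  change (conjKron (gamma t g) *ᵥ x.ofLp) (i, j) = _
  have key : ∀ i k, gamma t g i k =
      if g.right⁻¹ i = k then (((g.left : Fin d → rootsOfUnity N ℂ) i : ℂˣ) : ℂ) else 0 := by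
    intro i k
    change (phaseMat (g.left : Fin d → rootsOfUnity N ℂ) * permMat g.right) i k = _
    rw [phaseMat, Matrix.diagonal_mul]
    rw [permMat, Matrix.of_apply, mul_ite, mul_one, mul_zero,
      if_congr Equiv.Perm.inv_eq_iff_eq.symm rfl rfl]
  rw [Matrix.mulVec, dotProduct, Fintype.sum_prod_type]
  simp only [conjKron, Matrix.kroneckerMap_apply, Matrix.map_apply, key, apply_ite conj, map_zero]
  rw [Finset.sum_eq_single (g.right⁻¹ i)
      (fun b _ hb => by simp only [if_neg hb.symm, zero_mul, Finset.sum_const_zero]) (by simp),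
    Finset.sum_eq_single (g.right⁻¹ j)
      (fun b _ hb => by simp only [if_neg hb.symm, zero_mul, mul_zero]) (by simp)]
  simp only [if_true]

/-- The vectorisation of the diagonal matrix with a given diagonal. -/
def diagEmb (d : ℕ) : (Fin d → ℂ) →ₗ[ℂ] LSpace d where
  toFun v := WithLp.toLp 2 fun p => if p.1 = p.2 then v p.1 else 0
  map_add' v w := by ext p; by_cases h : p.1 = p.2 <;> simp [h]
  map_smul' c v := by ext p; by_cases h : p.1 = p.2 <;> simp [h]

theorem diagEmb_apply (v : Fin d → ℂ) (i j : Fin d) :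
    diagEmb d v (i, j) = if i = j then v i else 0 := rfl

theorem diagEmb_injective : Function.Injective (diagEmb d) := by
  intro v w h
  funext i
  simpa [diagEmb_apply] using congrArg (fun x : LSpace d => x (i, i)) h

/-- On diagonal matrices the phases cancel: the group acts by permuting the diagonal. -/
theorem channelRep_diagEmb [NeZero N] (t : Fin d → rootsOfUnity N ℂ) (g : HyperdihedralGroup t)
    (v : Fin d → ℂ) :
    channelRep t g (diagEmb d v) = diagEmb d fun i => v (g.right⁻¹ i) := by
  ext ⟨i, j⟩
  rw [channelRep_apply, diagEmb_apply, diagEmb_apply]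
  by_cases h : i = j
  · subst h
    simp [phase_mul_conj]
  · simp [h]

theorem exists_perm_map_pair {α : Type*} [DecidableEq α] {i j k l : α} (hij : i ≠ j)
    (hkl : k ≠ l) : ∃ σ : Equiv.Perm α, σ i = k ∧ σ j = l := by
  refine ⟨Equiv.swap (Equiv.swap i k j) l * Equiv.swap i k, ?_, ?_⟩
  · have h : k ≠ Equiv.swap i k j := fun h =>
      hij ((Equiv.swap i k).injective ((Equiv.swap_apply_left i k).trans h))
    simp [Equiv.swap_apply_of_ne_of_ne h hkl]
  · simp

/-- A non-scalar gate separates any two basis states: a permuted copy of it has distinct entries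
at `i` and `j`, so a matrix fixed by all phases has no entry there. -/
theorem eq_diagEmb_of_phase_fixed [NeZero N] {t : Fin d → rootsOfUnity N ℂ}
    (ht : ∃ i j, t i ≠ t j) {x : LSpace d}
    (hx : ∀ a : phaseGroup t, channelRep t (SemidirectProduct.inl a) x = x) :
    x = diagEmb d fun i => x (i, i) := by
  ext ⟨i, j⟩
  rw [diagEmb_apply]
  by_cases hij : i = j
  · simp [hij]
  obtain ⟨k, l, hkl⟩ := ht
  obtain ⟨σ, hk, hl⟩ := exists_perm_map_pair hij (fun h : k = l => hkl (h ▸ rfl))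
  let a : phaseGroup t := ⟨permPhase d N σ⁻¹ t, Subgroup.subset_closure ⟨_, rfl⟩⟩
  have h := congrArg (fun y : LSpace d => y (i, j)) (hx a)
  simp only [channelRep_apply, SemidirectProduct.left_inl, SemidirectProduct.right_inl, inv_one,
    Equiv.Perm.one_apply] at h
  have ai : (a : Fin d → rootsOfUnity N ℂ) i = t k := by
    change t (σ⁻¹⁻¹ i) = t k
    rw [inv_inv, hk]
  have aj : (a : Fin d → rootsOfUnity N ℂ) j = t l := by
    change t (σ⁻¹⁻¹ j) = t l
    rw [inv_inv, hl]
  rw [ai, aj] at h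
  rw [if_neg hij]
  by_contra hne
  have h1 : ((t k : ℂˣ) : ℂ) * conj ((t l : ℂˣ) : ℂ) = 1 :=
    mul_right_cancel₀ hne (h.trans (one_mul _).symm)
  have h2 : ((t k : ℂˣ) : ℂ) = ((t l : ℂˣ) : ℂ) := by
    have h3 := phase_mul_conj (t l)
    have hc : conj ((t l : ℂˣ) : ℂ) ≠ 0 := right_ne_zero_of_mul_eq_one h3
    exact mul_right_cancel₀ hc (h1.trans h3.symm)
  exact hkl (Subtype.ext (Units.ext h2))

/-- The trivial component consists of the scalar matrices. -/
theorem sigmaTriv_eq [NeZero N] {t : Fin d → rootsOfUnity N ℂ} (ht : ∃ i j, t i ≠ t j) :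
    sigmaTriv t = (Submodule.span ℂ {fun _ => (1 : ℂ)}).map (diagEmb d) := by
  apply le_antisymm
  · intro x hx
    rw [sigmaTriv, Representation.mem_invariants] at hx
    have hd := eq_diagEmb_of_phase_fixed ht fun a => hx _
    obtain ⟨k, -, -⟩ := ht
    refine ⟨fun i => x (i, i), ?_, hd.symm⟩
    rw [SetLike.mem_coe, Submodule.mem_span_singleton]
    refine ⟨x (k, k), funext fun i => ?_⟩
    have h := congrArg (fun y : LSpace d => y (i, i)) (hx (SemidirectProduct.inr (Equiv.swap i k)))
    simpa [channelRep_apply] using h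
  · rw [Submodule.map_span_le]
    rintro _ rfl
    rw [sigmaTriv, Representation.mem_invariants]
    intro g
    rw [channelRep_diagEmb]

/-- The sum of a vector over all permutations of its coordinates vanishes if the coordinate sum
does: the standard representation has no invariant vector. -/
theorem sum_stdRep_eq_zero (v : stdSpace d) : ∑ σ : Equiv.Perm (Fin d), stdRep d σ v = 0 := by
  set w := ∑ σ : Equiv.Perm (Fin d), stdRep d σ v with hw
  have hinv : ∀ τ : Equiv.Perm (Fin d), stdRep d τ w = w := by
    intro τ
    rw [hw, map_sum]
    simp_rw [← Module.End.mul_apply, ← map_mul]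
    exact Equiv.sum_comp (Equiv.mulLeft τ) fun σ => stdRep d σ v
  ext i
  have hconst : ∀ j, (w : Fin d → ℂ) j = (w : Fin d → ℂ) i := by
    intro j
    have h := congrArg (fun u : stdSpace d => (u : Fin d → ℂ) i) (hinv (Equiv.swap i j))
    have h' : (w : Fin d → ℂ) ((Equiv.swap i j)⁻¹ i) = (w : Fin d → ℂ) i := h
    simpa using h'
  have hs := mem_stdSpace.1 w.2
  simp_rw [hconst] at hs
  have hd : (d : ℂ) ≠ 0 := by
    have := i.pos
    exact_mod_cast this.ne'
  simpa [hd] using hs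

/-- The standard component consists of the diagonal matrices of trace zero. An intertwining map
lands in the diagonal matrices because the phases act trivially on its domain, and in trace zero
because the trace is invariant and the standard representation has no invariant vector. -/
theorem sigmaStd_eq [NeZero N] {t : Fin d → rootsOfUnity N ℂ} (ht : ∃ i j, t i ≠ t j) :
    sigmaStd t = (stdSpace d).map (diagEmb d) := by
  apply le_antisymm
  · refine iSup_le fun f => ?_
    rintro _ ⟨v, rfl⟩
    have hf : ∀ (g : HyperdihedralGroup t) (u : stdSpace d),
        channelRep t g (f.toLinearMap u) = f.toLinearMap (stdRep d g.right u) :=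
      fun g u => (f.isIntertwining _ _ g u).symm
    have hdiag : ∀ u, f.toLinearMap u = diagEmb d fun i => f.toLinearMap u (i, i) := by
      intro u
      refine eq_diagEmb_of_phase_fixed ht fun a => ?_
      rw [hf, SemidirectProduct.right_inl, map_one, Module.End.one_apply]
    refine ⟨_, ?_, (hdiag v).symm⟩
    rw [SetLike.mem_coe, mem_stdSpace]
    let tr : LSpace d →ₗ[ℂ] ℂ :=
      { toFun := fun x => ∑ i, x (i, i)
        map_add' := fun x y => by simp [Finset.sum_add_distrib]
        map_smul' := fun c x => by simp [Finset.mul_sum] }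
    have htr : ∀ σ : Equiv.Perm (Fin d),
        tr (f.toLinearMap (stdRep d σ v)) = tr (f.toLinearMap v) := by
      intro σ
      have h := hf (SemidirectProduct.inr σ) v
      rw [SemidirectProduct.right_inr] at h
      rw [← h, hdiag v, channelRep_diagEmb]
      simp only [tr, LinearMap.coe_mk, AddHom.coe_mk, diagEmb_apply, if_true,
        SemidirectProduct.right_inr]
      exact Equiv.sum_comp σ⁻¹ fun i => f.toLinearMap v (i, i)
    have h0 := congrArg (fun u => tr (f.toLinearMap u)) (sum_stdRep_eq_zero v)
    simp only [map_sum, htr, map_zero, Finset.sum_const, smul_eq_zero] at h0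
    exact h0.resolve_left Fintype.card_ne_zero
  · let f : (stdRepGroup t).IntertwiningMap (channelRep t) :=
      { toLinearMap := diagEmb d ∘ₗ (stdSpace d).subtype
        isIntertwining' := fun g => LinearMap.ext fun v => by
          exact (channelRep_diagEmb t g v).symm }
    rintro _ ⟨v, hv, rfl⟩
    exact Submodule.mem_iSup_of_mem f ⟨⟨v, hv⟩, rfl⟩

theorem finrank_stdSpace [NeZero d] : Module.finrank ℂ (stdSpace d) + 1 = d := by
  let s : (Fin d → ℂ) →ₗ[ℂ] ℂ := ∑ i, LinearMap.proj i
  have hs : LinearMap.range s = ⊤ :=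
    LinearMap.range_eq_top.2 fun c => ⟨Pi.single 0 c, by simp [s]⟩
  have h := s.finrank_range_add_finrank_ker
  rw [hs, finrank_top, Module.finrank_self, Module.finrank_fin_fun] at h
  rw [add_comm]
  exact h

theorem sigmaTriv_isOrtho_sigmaStd [NeZero N] {t : Fin d → rootsOfUnity N ℂ}
    (ht : ∃ i j, t i ≠ t j) : sigmaTriv t ⟂ sigmaStd t := by
  rw [sigmaTriv_eq ht, sigmaStd_eq ht, Submodule.isOrtho_iff_inner_eq]
  rintro _ ⟨u, hu, rfl⟩ _ ⟨v, hv, rfl⟩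
  obtain ⟨c, rfl⟩ := Submodule.mem_span_singleton.1 hu
  rw [SetLike.mem_coe, mem_stdSpace] at hv
  simp [PiLp.inner_apply, Fintype.sum_prod_type, diagEmb_apply, ← Finset.sum_mul, hv]

theorem finrank_sigmaTriv [NeZero N] {t : Fin d → rootsOfUnity N ℂ} (ht : ∃ i j, t i ≠ t j) :
    Module.finrank ℂ (sigmaTriv t) = 1 := by
  rw [sigmaTriv_eq ht, ← (Submodule.equivMapOfInjective _ diagEmb_injective _).finrank_eq]
  obtain ⟨k, -, -⟩ := ht
  exact finrank_span_singleton fun h => one_ne_zero (congrFun h k)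

theorem finrank_sigmaStd [NeZero N] {t : Fin d → rootsOfUnity N ℂ} (ht : ∃ i j, t i ≠ t j) :
    Module.finrank ℂ (sigmaStd t) + 1 = d := by
  have : NeZero d := ⟨by obtain ⟨k, -, -⟩ := ht; exact k.pos.ne'⟩
  rw [sigmaStd_eq ht, ← (Submodule.equivMapOfInjective _ diagEmb_injective _).finrank_eq,
    finrank_stdSpace]

theorem finrank_sigmaPlus [NeZero N] {t : Fin d → rootsOfUnity N ℂ} (ht : ∃ i j, t i ≠ t j) :
    Module.finrank ℂ (sigmaPlus t) + d = d ^ 2 := by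
  have h1 := (sigmaTriv t ⊔ sigmaStd t).finrank_add_finrank_orthogonal
  have h2 := Submodule.finrank_sup_add_finrank_inf_eq (sigmaTriv t) (sigmaStd t)
  rw [(sigmaTriv_isOrtho_sigmaStd ht).disjoint.eq_bot, finrank_bot, finrank_sigmaTriv ht] at h2
  have h3 := finrank_sigmaStd ht
  have h4 : Module.finrank ℂ (LSpace d) = d ^ 2 := by simp [sq]
  rw [h4] at h1
  rw [sigmaPlus]
  omega

theorem two_le_of_exists_ne {t : Fin d → rootsOfUnity N ℂ} (ht : ∃ i j, t i ≠ t j) : 2 ≤ d := by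
  obtain ⟨i, j, h⟩ := ht
  have hij : (i : ℕ) ≠ j := fun e => h (by rw [Fin.ext e])
  omega

/-- The three projectors add up to the identity, so `tr E` is the sum of the `η`'s weighted by the
dimensions `1`, `d - 1` and `d² - d` of the components. -/
theorem trace_eq_sum_eta [NeZero N] {t : Fin d → rootsOfUnity N ℂ} (ht : ∃ i j, t i ≠ t j)
    (E : SuperOp d) :
    E.trace = eta E (sigmaTriv t) + ((d : ℂ) - 1) * eta E (sigmaStd t)
      + ((d : ℂ) ^ 2 - d) * eta E (sigmaPlus t) := by
  have hd := two_le_of_exists_ne ht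
  have h0 : ((Module.finrank ℂ (sigmaStd t) : ℕ) : ℂ) = (d : ℂ) - 1 :=
    eq_sub_of_add_eq (by exact_mod_cast finrank_sigmaStd ht)
  have hp : ((Module.finrank ℂ (sigmaPlus t) : ℕ) : ℂ) = (d : ℂ) ^ 2 - d :=
    eq_sub_of_add_eq (by exact_mod_cast finrank_sigmaPlus ht)
  have h0' : (d : ℂ) - 1 ≠ 0 := by
    rw [sub_ne_zero]
    exact_mod_cast (by omega : d ≠ 1)
  have hp' : (d : ℂ) ^ 2 - d ≠ 0 := by
    rw [sq, ← mul_sub_one]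
    exact mul_ne_zero (by exact_mod_cast (by omega : d ≠ 0)) h0'
  rw [eta, eta, eta, finrank_sigmaTriv ht, h0, hp, Nat.cast_one, div_one,
    mul_div_cancel₀ _ h0', mul_div_cancel₀ _ hp', ← map_add, ← map_add, ← LinearMap.comp_add,
    ← LinearMap.comp_add]
  have hsum : ((sigmaTriv t).starProjection : LSpace d →ₗ[ℂ] LSpace d)
      + ((sigmaStd t).starProjection : LSpace d →ₗ[ℂ] LSpace d)
      + ((sigmaPlus t).starProjection : LSpace d →ₗ[ℂ] LSpace d) = LinearMap.id := by
    ext1 x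
    have h := (sigmaTriv t ⊔ sigmaStd t).starProjection_add_starProjection_orthogonal x
    rw [starProjection_sup_of_isOrtho (sigmaTriv_isOrtho_sigmaStd ht)] at h
    exact h
  rw [hsum, LinearMap.comp_id]
  exact (Matrix.trace_toLin_eq E (PiLp.basisFun 2 ℂ (Fin d × Fin d))).symm

end Components

/-! ### Unitary invariance of the measure on the unit sphere -/

section Invariance

open MeasureTheory Pointwise

variable {V : Type*} [NormedAddCommGroup V] [NormedSpace ℝ V] [FiniteDimensional ℝ V]
  [MeasurableSpace V] [BorelSpace V]

theorem map_linearIsometryEquiv_eq_self (μ : Measure V) [μ.IsAddHaarMeasure] (L : V ≃ₗᵢ[ℝ] V) :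
    μ.map L = μ := by
  have : (μ.map L).IsAddHaarMeasure :=
    L.toContinuousLinearEquiv.isAddHaarMeasure_map μ
  have hc := Measure.isAddLeftInvariant_eq_smul (μ.map L) μ
  -- The unit ball has the same positive finite measure for both, so the Haar factor is one.
  have hb := congrArg (fun ν : Measure V => ν (Metric.ball 0 1)) hc
  simp only [Measure.smul_apply] at hb
  rw [Measure.map_apply L.continuous.measurable Metric.isOpen_ball.measurableSet,
    L.preimage_ball, map_zero] at hb
  have hpos : μ (Metric.ball 0 1) ≠ 0 := (Metric.measure_ball_pos μ 0 one_pos).ne'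
  have hfin : μ (Metric.ball 0 1) ≠ ⊤ := measure_ball_lt_top.ne
  have h1 : ((Measure.addHaarScalarFactor (μ.map L) μ : NNReal) : ENNReal) = 1 := by
    have : 1 * μ (Metric.ball 0 1)
        = (Measure.addHaarScalarFactor (μ.map L) μ : NNReal) * μ (Metric.ball 0 1) := by
      rw [one_mul]; exact hb
    exact ((ENNReal.mul_left_inj hpos hfin).1 this).symm
  rw [hc, ENNReal.coe_eq_one.1 h1, one_smul]

/-- The action of a linear isometry on the unit sphere. -/
def sphereEquiv (L : V ≃ₗᵢ[ℝ] V) : Metric.sphere (0 : V) 1 ≃ₜ Metric.sphere (0 : V) 1 where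
  toFun x := ⟨L x, by simp⟩
  invFun x := ⟨L.symm x, by simp⟩
  left_inv x := by simp
  right_inv x := by simp
  continuous_toFun := by fun_prop
  continuous_invFun := by fun_prop

theorem map_toSphere_eq_self (μ : Measure V) [μ.IsAddHaarMeasure] (L : V ≃ₗᵢ[ℝ] V) :
    μ.toSphere.map (sphereEquiv L) = μ.toSphere := by
  ext s hs
  rw [Measure.map_apply (sphereEquiv L).continuous.measurable hs,
    Measure.toSphere_apply' _ ((sphereEquiv L).continuous.measurable hs),
    Measure.toSphere_apply' _ hs]
  congr 1
  have himg : (Set.Ioo (0 : ℝ) 1 • (((↑) : Metric.sphere (0 : V) 1 → V) '' (sphereEquiv L ⁻¹' s)))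
      = L ⁻¹' (Set.Ioo (0 : ℝ) 1 • (((↑) : Metric.sphere (0 : V) 1 → V) '' s)) := by
    ext x
    constructor
    · rintro ⟨r, hr, _, ⟨y, hy, rfl⟩, rfl⟩
      exact ⟨r, hr, _, ⟨_, hy, rfl⟩, by simp [sphereEquiv]⟩
    · rintro ⟨r, hr, _, ⟨y, hy, rfl⟩, hx⟩
      refine ⟨r, hr, _, ⟨(sphereEquiv L).symm y, by simpa using hy, rfl⟩, ?_⟩
      apply L.injective
      rw [← hx]
      simp [sphereEquiv]
  rw [himg]
  conv_rhs => rw [← map_linearIsometryEquiv_eq_self μ L]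
  exact (L.toHomeomorph.toMeasurableEquiv.map_apply _).symm

end Invariance

/-! ### The fourth moments of a random pure state -/

section Moments

open MeasureTheory

variable {d : ℕ}

local notation "ℋ" => EuclideanSpace ℂ (Fin d)

instance : IsFiniteMeasure (stateMeasure d) := by
  unfold stateMeasure; infer_instance

instance [NeZero d] : NeZero (stateMeasure d) :=
  ⟨by unfold stateMeasure; exact Measure.toSphere_ne_zero _⟩

/-- The average of a continuous function over all pure states, as a linear functional. The functions
live on the whole space, so that the coordinates are elements of the commutative ring `C(ℋ, ℂ)`. -/
noncomputable def stateAverage (d : ℕ) : C(EuclideanSpace ℂ (Fin d), ℂ) →ₗ[ℂ] ℂ where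
  toFun f := ⨍ ψ, f (ψ : EuclideanSpace ℂ (Fin d)) ∂(stateMeasure d)
  map_add' f g := by
    simp only [average_eq, ContinuousMap.add_apply]
    rw [integral_add, smul_add]
    all_goals
      refine Continuous.integrable_of_hasCompactSupport (by fun_prop) ?_
      exact HasCompactSupport.of_compactSpace _
  map_smul' c f := by
    simp only [average_eq, ContinuousMap.smul_apply, integral_smul, RingHom.id_apply]
    rw [smul_comm]

theorem stateAverage_apply (f : C(ℋ, ℂ)) :
    stateAverage d f = ⨍ ψ, f (ψ : ℋ) ∂(stateMeasure d) := rfl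

theorem stateAverage_congr {f g : C(ℋ, ℂ)} (h : ∀ ψ : ℋ, ‖ψ‖ = 1 → f ψ = g ψ) :
    stateAverage d f = stateAverage d g := by
  rw [stateAverage_apply, stateAverage_apply]
  congr 1
  funext ψ
  exact h ψ (by simp)

theorem stateAverage_one [NeZero d] : stateAverage d 1 = 1 := by
  rw [stateAverage_apply]
  simp

/-- The action of a matrix on the states. -/
noncomputable def matrixAction (U : Matrix (Fin d) (Fin d) ℂ) : C(ℋ, ℋ) :=
  ⟨fun ψ => WithLp.toLp 2 (U *ᵥ ψ.ofLp), by fun_prop⟩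

theorem matrixAction_apply (U : Matrix (Fin d) (Fin d) ℂ) (ψ : ℋ) (i : Fin d) :
    matrixAction U ψ i = ∑ j, U i j * ψ j := rfl

theorem stateAverage_comp_matrixAction {U : Matrix (Fin d) (Fin d) ℂ}
    (hU : U ∈ Matrix.unitaryGroup (Fin d) ℂ) (f : C(ℋ, ℂ)) :
    stateAverage d (f.comp (matrixAction U)) = stateAverage d f := by
  let L : ℋ ≃ₗᵢ[ℂ] ℋ := Unitary.linearIsometryEquiv
    ⟨Matrix.toEuclideanCLM (n := Fin d) (𝕜 := ℂ) U, Unitary.map_mem Matrix.toEuclideanCLM hU⟩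
  let L' : ℋ ≃ₗᵢ[ℝ] ℋ := { L.toLinearEquiv.restrictScalars ℝ with norm_map' := L.norm_map }
  have hmap : (stateMeasure d).map (sphereEquiv L') = stateMeasure d := map_toSphere_eq_self _ L'
  rw [stateAverage_apply, stateAverage_apply]
  rw [average_eq, average_eq]
  congr 1
  conv_rhs => rw [← hmap, (sphereEquiv L').measurableEmbedding.integral_map]
  rfl

/-- The coordinates of the state, as continuous functions. -/
noncomputable def coord (i : Fin d) : C(ℋ, ℂ) := ⟨fun ψ => ψ i, by fun_prop⟩

theorem coord_apply (i : Fin d) (ψ : ℋ) : coord i ψ = ψ i := rfl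

theorem coord_comp_matrixAction (U : Matrix (Fin d) (Fin d) ℂ) (i : Fin d) :
    (coord i).comp (matrixAction U) = ∑ j, U i j • coord j := by
  ext ψ
  simp [coord_apply, matrixAction_apply]

/-- The fourth moment `𝔼 ψᵢ ψ̄ⱼ ψₖ ψ̄ₗ` of a random pure state. -/
noncomputable def fourthMoment (i j k l : Fin d) : ℂ :=
  stateAverage d (coord i * star (coord j) * coord k * star (coord l))

theorem fourthMoment_swap_left (i j k l : Fin d) : fourthMoment i j k l = fourthMoment k j i l := by
  unfold fourthMoment
  congr 1
  ring

theorem fourthMoment_swap_right (i j k l : Fin d) :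
    fourthMoment i j k l = fourthMoment i l k j := by
  unfold fourthMoment
  congr 1
  ring

theorem fourthMoment_eq_comp {U : Matrix (Fin d) (Fin d) ℂ}
    (hU : U ∈ Matrix.unitaryGroup (Fin d) ℂ) (i j k l : Fin d) :
    fourthMoment i j k l =
      stateAverage d ((∑ p, U i p • coord p) * star (∑ p, U j p • coord p)
        * (∑ p, U k p • coord p) * star (∑ p, U l p • coord p)) := by
  simp only [← coord_comp_matrixAction]
  exact (stateAverage_comp_matrixAction hU _).symm

/-- Invariance of the moments under diagonal unitaries. -/
theorem fourthMoment_eq_phase_mul {u : Fin d → ℂ} (hu : ∀ p, u p * conj (u p) = 1)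
    (i j k l : Fin d) :
    fourthMoment i j k l = (u i * conj (u j) * u k * conj (u l)) * fourthMoment i j k l := by
  have hU : Matrix.diagonal u ∈ Matrix.unitaryGroup (Fin d) ℂ := by
    rw [Matrix.mem_unitaryGroup_iff, Matrix.star_eq_conjTranspose,
      Matrix.diagonal_conjTranspose, Matrix.diagonal_mul_diagonal, ← Matrix.diagonal_one]
    congr 1
    funext p
    exact hu p
  have hc : ∀ p : Fin d, ∑ q, Matrix.diagonal u p q • (coord q : C(ℋ, ℂ)) = u p • coord p := by
    intro p
    ext ψ
    simp only [ContinuousMap.sum_apply, ContinuousMap.smul_apply, smul_eq_mul,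
      Matrix.diagonal_apply, ite_mul, zero_mul, Finset.sum_ite_eq, Finset.mem_univ, if_true]
  conv_lhs => rw [fourthMoment_eq_comp hU i j k l]
  rw [fourthMoment]
  refine Eq.trans ?_ (map_smul (stateAverage d) _ _)
  congr 1
  simp only [hc]
  ext ψ
  simp
  ring

/-- A moment vanishes unless the plain indices match the conjugated ones: otherwise it changes
sign or picks up a factor `I` when a single unmatched coordinate is multiplied by `I`. -/
theorem fourthMoment_eq_zero {i j k l : Fin d} (h1 : ¬(i = j ∧ k = l)) (h2 : ¬(i = l ∧ j = k)) :
    fourthMoment i j k l = 0 := by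
  have key : ∀ p : Fin d, (∀ u : Fin d → ℂ, u p = Complex.I → (∀ q, q ≠ p → u q = 1) →
      u i * conj (u j) * u k * conj (u l) ≠ 1) → fourthMoment i j k l = 0 := by
    intro p hp
    let u : Fin d → ℂ := fun q => if q = p then Complex.I else 1
    have hu : ∀ q, u q * conj (u q) = 1 := fun q => by by_cases hq : q = p <;> simp [u, hq]
    by_contra h0
    have h := fourthMoment_eq_phase_mul hu i j k l
    refine hp u (by simp [u]) (fun q hq => by simp [u, hq]) ?_
    exact mul_right_cancel₀ h0 (h.symm.trans (one_mul _).symm)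
  have hI : Complex.I ≠ 1 := fun h => by simpa using congrArg Complex.re h
  by_cases hij : i = j
  · subst hij
    have hkl : k ≠ l := fun h => h1 ⟨rfl, h⟩
    refine key k fun u hk hu => ?_
    have hui : u i * conj (u i) = 1 := by
      by_cases hik : i = k
      · rw [hik, hk]; simp
      · rw [hu i hik]; simp
    rw [hui, hk, hu l hkl.symm]
    simpa using hI
  by_cases hil : i = l
  · subst hil
    have hjk : j ≠ k := fun h => h2 ⟨rfl, h⟩
    refine key k fun u hk hu => ?_
    have hui : u i * conj (u i) = 1 := by
      by_cases hik : i = k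
      · rw [hik, hk]; simp
      · rw [hu i hik]; simp
    rw [hk, hu j hjk, map_one, mul_one, mul_right_comm, hui, one_mul]
    exact hI
  · refine key i fun u hi hu => ?_
    rw [hi, hu j (Ne.symm hij), hu l (Ne.symm hil)]
    by_cases hki : k = i
    · rw [hki, hi]
      norm_num
    · rw [hu k hki]
      simpa using hI

/-- Invariance under the Householder reflection along `e i + 2 • e j`, which acts on the plane of
`i` and `j` with the rational entries `3/5`, `-4/5`, `-3/5`. -/
theorem fourthMoment_relation {i j : Fin d} (hij : i ≠ j) :
    544 * fourthMoment i i i i = 256 * fourthMoment j j j j + 576 * fourthMoment i i j j := by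
  let w : Fin d → ℂ := Pi.single i 1 + Pi.single j 2
  have hw : w ⬝ᵥ w = 5 := by
    simp [w, hij, hij.symm]
    norm_num
  have hstar : (Matrix.vecMulVec w w)ᴴ = Matrix.vecMulVec w w := by
    have hs : star w = w := by
      funext p
      simp only [w, Pi.star_apply, Pi.add_apply, star_add, Pi.single_apply]
      split_ifs <;> simp
    rw [Matrix.conjTranspose_vecMulVec, hs]
  let U : Matrix (Fin d) (Fin d) ℂ := 1 - (2 / 5 : ℂ) • Matrix.vecMulVec w w
  have hU : U ∈ Matrix.unitaryGroup (Fin d) ℂ := by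
    have hc : Uᴴ = U := by
      simp [U, Matrix.conjTranspose_sub, Matrix.conjTranspose_smul, hstar]
    rw [Matrix.mem_unitaryGroup_iff, Matrix.star_eq_conjTranspose, hc]
    have hsq : Matrix.vecMulVec w w * Matrix.vecMulVec w w = (5 : ℂ) • Matrix.vecMulVec w w := by
      rw [Matrix.vecMulVec_mul_vecMulVec, hw, Matrix.vecMulVec_smul]
    simp only [U, sub_mul, mul_sub, one_mul, mul_one, smul_mul_assoc, mul_smul_comm, hsq]
    module
  have hrow : ∑ p, U i p • (coord p : C(ℋ, ℂ)) =
      (3 / 5 : ℂ) • coord i + (-4 / 5 : ℂ) • coord j := by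
    ext ψ
    simp [U, w, Matrix.vecMulVec_apply, Matrix.one_apply, sub_mul, mul_add, add_mul,
      Finset.sum_add_distrib, Finset.sum_sub_distrib, Pi.single_apply, hij]
    ring
  let M : Fin d → Fin d → Fin d → Fin d → C(ℋ, ℂ) :=
    fun p q r s => coord p * star (coord q) * coord r * star (coord s)
  have h := fourthMoment_eq_comp hU i i i i
  have hexp : ((3 / 5 : ℂ) • coord i + (-4 / 5 : ℂ) • coord j)
      * star ((3 / 5 : ℂ) • coord i + (-4 / 5 : ℂ) • coord j)
      * ((3 / 5 : ℂ) • coord i + (-4 / 5 : ℂ) • coord j)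
      * star ((3 / 5 : ℂ) • coord i + (-4 / 5 : ℂ) • coord j)
      = (81 / 625 : ℂ) • M i i i i + (256 / 625 : ℂ) • M j j j j + (576 / 625 : ℂ) • M i i j j
        + (144 / 625 : ℂ) • (M i j i j + M j i j i)
        - (216 / 625 : ℂ) • (M i i i j + M i i j i)
        - (384 / 625 : ℂ) • (M i j j j + M j i j j) := by
    ext ψ
    simp [M]
    ring
  have hM : ∀ p q r s, stateAverage d (M p q r s) = fourthMoment p q r s := fun _ _ _ _ => rfl
  rw [hrow, hexp] at h
  simp only [map_add, map_sub, map_smul, hM, smul_eq_mul] at h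
  rw [fourthMoment_eq_zero (i := i) (j := j) (k := i) (l := j) (by tauto) (by tauto),
    fourthMoment_eq_zero (i := j) (j := i) (k := j) (l := i) (by tauto) (by tauto),
    fourthMoment_eq_zero (i := i) (j := i) (k := i) (l := j) (by tauto) (by tauto),
    fourthMoment_eq_zero (i := i) (j := i) (k := j) (l := i) (by tauto) (by tauto),
    fourthMoment_eq_zero (i := i) (j := j) (k := j) (l := j) (by tauto) (by tauto),
    fourthMoment_eq_zero (i := j) (j := i) (k := j) (l := j) (by tauto) (by tauto)] at h
  linear_combination 625 * h

theorem fourthMoment_pair {i j : Fin d} (hij : i ≠ j) :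
    fourthMoment j j j j = fourthMoment i i i i ∧
      fourthMoment i i j j = fourthMoment i i i i / 2 := by
  have h1 := fourthMoment_relation hij
  have h2 := fourthMoment_relation hij.symm
  rw [fourthMoment_swap_left j j i i, fourthMoment_swap_right i j j i] at h2
  constructor
  · linear_combination (1 / 800) * h2 - (1 / 800) * h1
  · linear_combination -(544 / 460800 : ℂ) * h1 - (256 / 460800 : ℂ) * h2

theorem sum_fourthMoment [NeZero d] : ∑ i : Fin d, ∑ j, fourthMoment i i j j = 1 := by
  rw [← stateAverage_one (d := d)]
  simp only [fourthMoment, ← map_sum]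
  refine stateAverage_congr fun ψ hψ => ?_
  have hs : ∑ i, ψ i * conj (ψ i) = 1 := by
    have h := EuclideanSpace.norm_sq_eq ψ
    simp only [Complex.mul_conj, Complex.normSq_eq_norm_sq]
    rw [hψ] at h
    exact_mod_cast h.symm.trans (one_pow 2)
  simp only [ContinuousMap.sum_apply, ContinuousMap.mul_apply, ContinuousMap.star_apply,
    coord_apply, mul_assoc, ContinuousMap.one_apply]
  simp only [← mul_assoc (ψ _) (star (ψ _)) (ψ _ * star (ψ _)), ← Finset.mul_sum]
  change ∑ i, ψ i * conj (ψ i) * ∑ j, ψ j * conj (ψ j) = 1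
  rw [hs]
  simpa using hs

/-- Moments of a random pure state: only the two pairings contribute, equally. -/
theorem fourthMoment_eq (i j k l : Fin d) :
    fourthMoment i j k l =
      ((if i = j ∧ k = l then 1 else 0) + (if i = l ∧ j = k then 1 else 0))
        / ((d : ℂ) * ((d : ℂ) + 1)) := by
  have : NeZero d := ⟨i.pos.ne'⟩
  have hd : (d : ℂ) ≠ 0 := NeZero.ne _
  have hd' : (d : ℂ) + 1 ≠ 0 := by exact_mod_cast d.succ_ne_zero
  obtain ⟨a, hp⟩ : ∃ a, ∀ p : Fin d, fourthMoment p p p p = a := by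
    refine ⟨fourthMoment i i i i, fun p => ?_⟩
    by_cases h : i = p
    · rw [h]
    · exact (fourthMoment_pair h).1
  have hdiag : ∀ p q : Fin d, fourthMoment p p q q = (1 + if p = q then 1 else 0) / 2 * a := by
    intro p q
    by_cases h : p = q
    · rw [← h, if_pos rfl, hp]
      ring
    · rw [(fourthMoment_pair h).2, if_neg h, hp]
      ring
  have hsum := sum_fourthMoment (d := d)
  simp only [hdiag, ← Finset.sum_mul, ← Finset.sum_div, Finset.sum_add_distrib, Finset.sum_const,
    Finset.card_univ, Fintype.card_fin, Finset.sum_ite_eq, Finset.mem_univ, if_true,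
    nsmul_eq_mul, mul_one] at hsum
  have ha : a = 2 / ((d : ℂ) * ((d : ℂ) + 1)) := by
    rw [eq_div_iff (mul_ne_zero hd hd')]
    linear_combination 2 * hsum
  generalize (d : ℂ) * ((d : ℂ) + 1) = D at ha ⊢
  by_cases h1 : i = j ∧ k = l
  · obtain ⟨rfl, rfl⟩ := h1
    rw [hdiag, ha]
    by_cases h : i = k <;> simp [h] <;> ring
  by_cases h2 : i = l ∧ j = k
  · obtain ⟨rfl, rfl⟩ := h2
    rw [fourthMoment_swap_right, hdiag, ha, if_neg h1]
    have h : i ≠ j := fun h => h1 ⟨h, h.symm⟩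
    simp [h]
    ring
  · rw [fourthMoment_eq_zero h1 h2, if_neg h1, if_neg h2]
    simp

/-- The overlap `⟪|ψ⟩⟨ψ|, F(|ψ⟩⟨ψ|)⟫` as a function of `ψ`; its average over the unit vectors is the
fidelity of `F` as an implementation of the identity. -/
noncomputable def overlap (F : SuperOp d) : C(ℋ, ℂ) :=
  ∑ p : Fin d × Fin d, ∑ q : Fin d × Fin d,
    F p q • (coord p.2 * star (coord p.1) * coord q.1 * star (coord q.2))

theorem overlap_apply (F : SuperOp d) (ψ : ℋ) :
    overlap F ψ = star (pureState ψ) ⬝ᵥ (F *ᵥ pureState ψ) := by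
  simp only [overlap, ContinuousMap.sum_apply, dotProduct, Matrix.mulVec, Finset.mul_sum]
  refine Finset.sum_congr rfl fun p _ => Finset.sum_congr rfl fun q _ => ?_
  simp [pureState, coord_apply]
  ring

theorem stateAverage_overlap (F : SuperOp d) :
    stateAverage d (overlap F)
      = ((∑ i, ∑ k, F (i, i) (k, k)) + F.trace) / ((d : ℂ) * ((d : ℂ) + 1)) := by
  have h : ∀ p q : Fin d × Fin d,
      stateAverage d (F p q • (coord p.2 * star (coord p.1) * coord q.1 * star (coord q.2)))
      = F p q * fourthMoment p.2 p.1 q.1 q.2 := fun p q => map_smul _ _ _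
  simp only [overlap, map_sum, h, fourthMoment_eq]
  simp only [← mul_div_assoc, ← Finset.sum_div, mul_add, Finset.sum_add_distrib]
  congr 2
  · simp only [Fintype.sum_prod_type, ite_and, mul_ite, mul_one, mul_zero]
    simp
  · rw [Matrix.trace]
    refine Finset.sum_congr rfl fun p _ => ?_
    rw [Finset.sum_eq_single p]
    · simp
    · intro q _ hq
      rw [if_neg (fun h => hq (Prod.ext h.2.symm h.1.symm)), mul_zero]
    · simp

/-- The channel of `U` sends the pure state of `ψ` to that of `U ψ`. -/
theorem conjKron_mulVec_pureState (U : Matrix (Fin d) (Fin d) ℂ) (ψ : ℋ) :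
    conjKron U *ᵥ pureState ψ = pureState (matrixAction U ψ) := by
  funext p
  simp only [pureState, matrixAction_apply, map_sum, Finset.sum_mul_sum, Matrix.mulVec, dotProduct,
    Fintype.sum_prod_type]
  refine Finset.sum_congr rfl fun q _ => Finset.sum_congr rfl fun r _ => ?_
  simp [conjKron]
  ring

/-- The fidelity of a unitary gate followed by noise `F` does not depend on the gate. -/
theorem gateFidelity_conjKron {U : Matrix (Fin d) (Fin d) ℂ}
    (hU : U ∈ Matrix.unitaryGroup (Fin d) ℂ) (F : SuperOp d) :
    gateFidelity (conjKron U) (F * conjKron U)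
      = ((∑ i, ∑ k, F (i, i) (k, k)) + F.trace) / ((d : ℂ) * ((d : ℂ) + 1)) := by
  rw [← stateAverage_overlap, ← stateAverage_comp_matrixAction hU, stateAverage_apply,
    gateFidelity]
  congr 1
  funext ψ
  rw [← Matrix.mulVec_mulVec, conjKron_mulVec_pureState, ContinuousMap.comp_apply, overlap_apply]

end Moments

/-! ### Average over the group -/

section Average

variable {d N : ℕ}

theorem gateFidelity_noisyGate [NeZero N] (t : Fin d → rootsOfUnity N ℂ) [NeZero d]
    {E : SuperOp d} (hE : E ∈ channels d) (g : HyperdihedralGroup t) :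
    gateFidelity (idealGate t g) (noisyGate t E g)
      = 1 / ((d : ℂ) * ((d : ℂ) + 1)) * E.trace + 1 / ((d : ℂ) + 1) := by
  have h := gateFidelity_conjKron (gamma_mem_unitaryGroup t g) E
  rw [Finset.sum_comm] at h
  simp only [sum_diag_of_mem_channels hE, Finset.sum_const, Finset.card_univ, Fintype.card_fin,
    nsmul_eq_mul, mul_one] at h
  refine h.trans ?_
  have hd : (d : ℂ) ≠ 0 := NeZero.ne _
  have hd' : (d : ℂ) + 1 ≠ 0 := by exact_mod_cast d.succ_ne_zero
  field_simp
  ring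

theorem groupFidelity_of_const [NeZero N] {fid : SuperOp d → SuperOp d → ℂ}
    {t : Fin d → rootsOfUnity N ℂ} {E : SuperOp d} {c : ℂ}
    (h : ∀ g, fid (idealGate t g) (noisyGate t E g) = c) : groupFidelity fid t E = c := by
  rw [groupFidelity, Finset.sum_congr rfl fun g _ => h g, Finset.sum_const, Finset.card_univ,
    nsmul_eq_mul, inv_mul_cancel_left₀ (Nat.cast_ne_zero.2 Fintype.card_ne_zero)]

end Average

end RHDG

theorem mainTheorem3 (d N : ℕ) [NeZero N]
    (t : Fin d → rootsOfUnity N ℂ) (ht : ∃ i j, t i ≠ t j)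
    (E : RHDG.SuperOp d) (hE : E ∈ RHDG.channels d) :
    RHDG.groupFidelity RHDG.gateFidelity t E =
        ((d : ℂ) * (RHDG.eta E (RHDG.sigmaTriv t) + ((d : ℂ) - 1) * RHDG.eta E (RHDG.sigmaStd t)
          + ((d : ℂ) ^ 2 - d) * RHDG.eta E (RHDG.sigmaPlus t)) + (d : ℂ) ^ 2)
        / ((d : ℂ) ^ 2 * ((d : ℂ) + 1)) ∧
    RHDG.groupFidelity RHDG.traceFidelity t E =
        ((d : ℂ) * (RHDG.eta E (RHDG.sigmaTriv t) + ((d : ℂ) - 1) * RHDG.eta E (RHDG.sigmaStd t)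
          + ((d : ℂ) ^ 2 - d) * RHDG.eta E (RHDG.sigmaPlus t)) + (d : ℂ) ^ 2)
        / ((d : ℂ) ^ 2 * ((d : ℂ) + 1)) := by
  have : NeZero d := ⟨by have := RHDG.two_le_of_exists_ne ht; omega⟩
  have hd : (d : ℂ) ≠ 0 := NeZero.ne _
  have hd' : (d : ℂ) + 1 ≠ 0 := by exact_mod_cast d.succ_ne_zero
  rw [← RHDG.trace_eq_sum_eta ht E,
    RHDG.groupFidelity_of_const (RHDG.gateFidelity_noisyGate t hE),
    RHDG.groupFidelity_of_const (RHDG.traceFidelity_noisyGate t hE), and_self]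
  field_simp
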